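/- Fix an integer $n\ge 1$. Let $B_{2n}$ be the braid group on $2n$ strands with Artin generators $\sigma_1,\dots,\sigma_{2n-1}$, and let $<_D$ be the Dehornoy order on it: $\beta<_D\gamma$ if and only if $\beta^{-1}\gamma$ is represented by a nonempty braid word in which the generator $\sigma_i$ of smallest index that occurs never occurs with a negative exponent. Let $H_{2n}\le B_{2n}$ be the Hilden subgroup, that is, the subgroup of those braids whose action on the plane with $2n$ marked points (regarded as part of the boundary sphere of the ball $B^3$) extends to a homeomorphism of the pair $(B^3,\tau_n)$, where $\tau_n$ is the standard trivial $n$-string tangle joining the marked points in adjacent pairs. Let $\mathcal P_{2n}=H_{2n}\backslash B_{2n}/H_{2n}$ be the set of Hilden double cosets. Let $c_n\colon B_{2n}\to\mathbb N$ be a proper complexity function, i.e. $\{\beta\in B_{2n} : c_n(\beta)\le N\}$ is finite for every $N\in\mathbb N$. For $C\in\mathcal P_{2n}$ let $M_n(C)$ be the (finite, nonempty) set of the elements of $C$ at which $c_n|_C$ takes its minimal value, and let $r_{D,n}(C)$ be the $<_D$-least element of $M_n(C)$. Let $\mathcal L$ be a link type in $S^3$, i.e. the ambient isotopy class of a tame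 (unoriented) link, and let $$\mathcal P^{(n)}(\mathcal L)=\{C\in\mathcal P_{2n} : \text{the plat closure of some } \beta\in C \text{ belongs to } \mathcal L\},$$ where the plat closure of a braid is obtained by joining its top endpoints, and its bottom endpoints, in adjacent pairs. Then the following are equivalent: 1. $\mathcal P^{(n)}(\mathcal L)$ is finite. 2. There is a constant $N=N(n,\mathcal L)\in\mathbb N$ (which may also depend on the fixed function $c_n$) such that $c_n(r_{D,n}(C))\le N$ for every $C\in\mathcal P^{(n)}(\mathcal L)$. -/

import Mathlib

noncomputable section

namespace Plat

/-! ### The braid group and the Dehornoy order -/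

/-- The Artin relations between the generators `σ 0, …, σ (m - 2)` on `m` strands. -/
inductive BraidRel (m : ℕ) : FreeGroup (Fin (m - 1)) → Prop
  | comm (i j : Fin (m - 1)) (h : i.val + 2 ≤ j.val) :
      BraidRel m (FreeGroup.of i * FreeGroup.of j *
        (FreeGroup.of j * FreeGroup.of i)⁻¹)
  | braid (i j : Fin (m - 1)) (h : i.val + 1 = j.val) :
      BraidRel m (FreeGroup.of i * FreeGroup.of j * FreeGroup.of i *
        (FreeGroup.of j * FreeGroup.of i * FreeGroup.of j)⁻¹)

/-- The braid group on `m` strands, in Artin's presentation. -/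
abbrev BraidGroup (m : ℕ) : Type :=
  PresentedGroup {r | BraidRel m r}

/-- Braid words: the letter `(i, true)` is `σ i` and `(i, false)` is its inverse. -/
abbrev BraidWord (m : ℕ) : Type := List (Fin (m - 1) × Bool)

/-- The braid represented by a braid word. -/
def BraidWord.toBraid {m : ℕ} (w : BraidWord m) : BraidGroup m :=
  PresentedGroup.mk {r | BraidRel m r} (FreeGroup.mk w)

/-- A braid is `σ`-positive if it is represented by some nonempty word in which the generator of
smallest index among those that occur only occurs with positive exponent. -/
def IsSigmaPositive {m : ℕ} (β : BraidGroup m) : Prop :=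
  ∃ (w : BraidWord m) (i : Fin (m - 1)), w.toBraid = β ∧
    (i, true) ∈ w ∧ (i, false) ∉ w ∧ ∀ x ∈ w, i ≤ x.1

/-- The (strict) Dehornoy order on the braid group. -/
def DehornoyLT {m : ℕ} (β γ : BraidGroup m) : Prop := IsSigmaPositive (β⁻¹ * γ)

/-- `β` is the least element of `S` for the Dehornoy order. -/
def IsDehornoyLeast {m : ℕ} (S : Set (BraidGroup m)) (β : BraidGroup m) : Prop :=
  β ∈ S ∧ ∀ γ ∈ S, γ ≠ β → DehornoyLT β γ

/-! ### Braids as homeomorphisms of the plane with marked points `0, 1, …, m - 1` -/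

/-- The angle function of a half twist: `1` for `r ≤ 1/2`, and `0` for `r ≥ 1`. -/
def twistProfile (r : ℝ) : ℝ := max 0 (min 1 (2 - 2 * r))

/-- Rotate the circle of radius `r` about `c` by the angle `s * π * twistProfile r`. -/
def twistMap (c : ℂ) (s : ℝ) (z : ℂ) : ℂ :=
  c + Complex.exp ((s * (Real.pi * twistProfile ‖z - c‖) : ℝ) * Complex.I) * (z - c)

theorem continuous_twistMap (c : ℂ) (s : ℝ) : Continuous (twistMap c s) := by
  unfold twistMap twistProfile
  fun_prop

theorem twistMap_twistMap (c : ℂ) (s : ℝ) (z : ℂ) :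
    twistMap c (-s) (twistMap c s z) = z := by
  have h : ‖twistMap c s z - c‖ = ‖z - c‖ := by
    simp only [twistMap, add_sub_cancel_left, norm_mul, Complex.norm_exp_ofReal_mul_I, one_mul]
  have h' : twistMap c (-s) (twistMap c s z) = c + Complex.exp
      ((-s * (Real.pi * twistProfile ‖twistMap c s z - c‖) : ℝ) * Complex.I) *
        (twistMap c s z - c) := rfl
  rw [h', h]
  simp only [twistMap, add_sub_cancel_left]
  rw [← mul_assoc, ← Complex.exp_add]
  simp

/-- The point half way between the marked points `i` and `i + 1`. -/
def midpt (i : ℕ) : ℂ := (i : ℂ) + 1 / 2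

/-- The half twist exchanging the marked points `i` and `i + 1`; it is supported in the disc of
radius `1` about their midpoint, hence fixes all other marked points. -/
def halfTwist (i : ℕ) : ℂ ≃ₜ ℂ where
  toFun := twistMap (midpt i) 1
  invFun := twistMap (midpt i) (-1)
  left_inv := twistMap_twistMap (midpt i) 1
  right_inv z := by simpa using twistMap_twistMap (midpt i) (-1) z
  continuous_toFun := continuous_twistMap _ _
  continuous_invFun := continuous_twistMap _ _

/-- The homeomorphism of the plane by which a braid word acts. -/
def planeAction (m : ℕ) : FreeGroup (Fin (m - 1)) →* (ℂ ≃ₜ ℂ) :=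
  FreeGroup.lift fun i => halfTwist i.val

/-! ### The standard trivial tangle and the Hilden subgroup -/

/-- The closed upper half space. -/
abbrev HalfSpace : Type := {p : ℂ × ℝ // 0 ≤ p.2}

/-- The closed 3-ball, as the one-point compactification of the closed upper half space. -/
abbrev Ball3 : Type := OnePoint HalfSpace

/-- The inclusion of the plane in the boundary sphere of the ball. -/
def bdry (z : ℂ) : Ball3 := ((⟨(z, 0), le_refl 0⟩ : HalfSpace) : OnePoint HalfSpace)

/-- The `n` semicircles in the upper half space over the adjacent pairs of marked points
`0, 1`, then `2, 3`, up to `2n - 2, 2n - 1`. -/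
def caps (n : ℕ) : Set (ℂ × ℝ) :=
  {p | 0 ≤ p.2 ∧ p.1.im = 0 ∧
    ∃ k < n, (p.1.re - (2 * (k : ℝ) + 1 / 2)) ^ 2 + p.2 ^ 2 = (1 / 2) ^ 2}

/-- The standard trivial `n`-string tangle in the ball. -/
def trivialTangle (n : ℕ) : Set Ball3 :=
  (fun p : HalfSpace => (p : OnePoint HalfSpace)) '' {p | p.val ∈ caps n}

/-- The homeomorphisms of the plane that extend to a homeomorphism of the pair formed by the
ball and the standard trivial tangle. -/
def extendable (n : ℕ) : Subgroup (ℂ ≃ₜ ℂ) where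
  carrier := {f | ∃ F : Ball3 ≃ₜ Ball3,
    (∀ z, F (bdry z) = bdry (f z)) ∧ F '' trivialTangle n = trivialTangle n}
  one_mem' := ⟨Homeomorph.refl _, fun _ => rfl, by simp⟩
  mul_mem' := by
    rintro f g ⟨F, hF, hF'⟩ ⟨G, hG, hG'⟩
    refine ⟨G.trans F, fun z => ?_, ?_⟩
    · simp only [Homeomorph.trans_apply, hG, hF]
      rfl
    · change (F ∘ G) '' trivialTangle n = trivialTangle n
      rw [Set.image_comp, hG', hF']
  inv_mem' := by
    rintro f ⟨F, hF, hF'⟩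
    refine ⟨F.symm, fun z => ?_, ?_⟩
    · rw [Homeomorph.symm_apply_eq, hF]
      exact congrArg bdry (f.apply_symm_apply z).symm
    · conv_lhs => rw [← hF']
      rw [← Set.image_comp]
      simp

/-- The Hilden subgroup of the braid group on `2n` strands. -/
def hilden (n : ℕ) : Subgroup (BraidGroup (2 * n)) :=
  ((extendable n).comap (planeAction (2 * n))).map
    (PresentedGroup.mk {r | BraidRel (2 * n) r})

/-- The set of `2n`-plat presentation classes: Hilden double cosets. -/
abbrev PlatClass (n : ℕ) : Type :=
  DoubleCoset.Quotient (hilden n : Set (BraidGroup (2 * n))) (hilden n : Set (BraidGroup (2 * n)))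

/-- A plat presentation class as a set of braids. -/
def PlatClass.braids {n : ℕ} (C : PlatClass n) : Set (BraidGroup (2 * n)) :=
  {β | DoubleCoset.mk (hilden n) (hilden n) β = C}

/-! ### Links in the 3-sphere, link types, plat closures -/

/-- The 3-sphere, as the one-point compactification of 3-space. -/
abbrev Sphere3 : Type := OnePoint (ℂ × ℝ)

/-- A (tame) link: a nonempty closed locally flat 1-dimensional submanifold of the 3-sphere. -/
def IsLink (K : Set Sphere3) : Prop :=
  K.Nonempty ∧ IsClosed K ∧ ∀ p ∈ K, ∃ e : OpenPartialHomeomorph Sphere3 (ℂ × ℝ),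
    p ∈ e.source ∧ e.target = Set.univ ∧ e '' (e.source ∩ K) = {q | q.1 = 0}

/-- Ambient isotopy of subsets of the 3-sphere. -/
def AmbientIsotopic (K K' : Set Sphere3) : Prop :=
  ∃ H : unitInterval → (Sphere3 ≃ₜ Sphere3),
    Continuous (fun p : unitInterval × Sphere3 => H p.1 p.2) ∧
    H 0 = Homeomorph.refl Sphere3 ∧ H 1 '' K = K'

/-- A link type: the ambient isotopy class of a link. -/
def IsLinkType (L : Set (Set Sphere3)) : Prop :=
  ∃ K, IsLink K ∧ L = {K' | AmbientIsotopic K K'}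

/-- The positions in the plane of the `m` strands at time `s ∈ [0, 1]` of a letter of a braid
word: the strands at `i` and `i + 1` make half a turn about each other. -/
def letterPoints (m : ℕ) (x : Fin (m - 1) × Bool) (s : ℝ) : Set ℂ :=
  {z | ∃ l < m, l ≠ x.1.val ∧ l ≠ x.1.val + 1 ∧ z = (l : ℂ)} ∪
  {z | ∃ d : ℂ, (d = 1 / 2 ∨ d = -(1 / 2)) ∧
    z = midpt x.1.val +
      Complex.exp (((if x.2 then 1 else -1) * (Real.pi * s) : ℝ) * Complex.I) * d}

/-- The geometric braid of a word, running from height `0` down to height `-w.length`. -/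
def strands {m : ℕ} (w : BraidWord m) : Set (ℂ × ℝ) :=
  {p | ∃ (j : Fin w.length) (s : ℝ), 0 ≤ s ∧ s ≤ 1 ∧
    p.2 = -((j.val : ℝ) + s) ∧ p.1 ∈ letterPoints m (w.get j) s}

/-- The plat closure of a braid word: the top endpoints, and the bottom endpoints, of the
geometric braid are joined in adjacent pairs by semicircles. -/
def platClosure {n : ℕ} (w : BraidWord (2 * n)) : Set Sphere3 :=
  (fun p : ℂ × ℝ => (p : OnePoint (ℂ × ℝ))) ''
    (caps n ∪ strands w ∪ {p | (p.1, -(w.length : ℝ) - p.2) ∈ caps n})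

/-- The plat closure of the braid `β` belongs to the link type `L`. -/
def PlatRepresents {n : ℕ} (β : BraidGroup (2 * n)) (L : Set (Set Sphere3)) : Prop :=
  ∃ w : BraidWord (2 * n), w.toBraid = β ∧ platClosure w ∈ L

/-- The plat presentation classes that represent the link type `L`. (If `n` is smaller than the
bridge number of `L`, this is empty, since a plat closure on `2n` strands has `n` bridges.) -/
def platClasses (n : ℕ) (L : Set (Set Sphere3)) : Set (PlatClass n) :=
  {C | ∃ β ∈ C.braids, PlatRepresents β L}

/-! ### Complexity and canonical representatives -/

/-- Proper complexity functions at level `n`. -/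
def IsProperComplexity {n : ℕ} (c : BraidGroup (2 * n) → ℕ) : Prop :=
  ∀ N : ℕ, {β | c β ≤ N}.Finite

/-- The minimal complexity of a braid in the class. -/
def classComplexity {n : ℕ} (c : BraidGroup (2 * n) → ℕ) (C : PlatClass n) : ℕ :=
  sInf (c '' C.braids)

/-- The braids of minimal complexity in the class. -/
def minimalBraids {n : ℕ} (c : BraidGroup (2 * n) → ℕ) (C : PlatClass n) :
    Set (BraidGroup (2 * n)) :=
  {β | β ∈ C.braids ∧ c β = classComplexity c C}

theorem minimalBraids_nonempty {n : ℕ} (c : BraidGroup (2 * n) → ℕ) (C : PlatClass n) :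
    (minimalBraids c C).Nonempty := by
  have h : (c '' C.braids).Nonempty := by
    obtain ⟨β, hβ⟩ := Quotient.exists_rep C
    exact ⟨c β, β, hβ, rfl⟩
  obtain ⟨β, hβ, hc⟩ := Nat.sInf_mem h
  exact ⟨β, hβ, hc⟩

open Classical in
/-- The Dehornoy canonical representative: the least braid, for the Dehornoy order, among those
of minimal complexity in the class. (For a proper `c` these are finitely many, and the Dehornoy
order is total, so the least one exists; the second branch only makes the function total.) -/
def canonicalRep {n : ℕ} (c : BraidGroup (2 * n) → ℕ) (C : PlatClass n) :
    BraidGroup (2 * n) :=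
  if h : ∃ β, IsDehornoyLeast (minimalBraids c C) β then h.choose
  else (minimalBraids_nonempty c C).choose

end Plat

end

namespace Plat

/-! Choosing a representative in each double coset gives a section of the quotient map from braids
to plat classes, and a section is injective. If the complexity of the representatives is bounded by
`N` on a set of classes, the section embeds that set in `{β | c β ≤ N}`, which is finite by
properness; conversely, finitely many natural numbers have an upper bound. The argument is carried
by `mk_canonicalRep` and `canonicalRep_injective`, and it works for an arbitrary set of classes. -/

/-- The canonical representative of a class is a braid of minimal complexity in the class. -/
theorem canonicalRep_mem_minimalBraids {n : ℕ} (c : BraidGroup (2 * n) → ℕ) (C : PlatClass n) :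
    canonicalRep c C ∈ minimalBraids c C := by
  unfold canonicalRep
  -- Both branches choose from `minimalBraids c C`, so the existence of a Dehornoy-least element
  -- need not be proved here.
  split_ifs with h
  · exact h.choose_spec.1
  · exact (minimalBraids_nonempty c C).choose_spec

/-- The section property. Of minimality only the membership in the class is kept; it unfolds to this
equation. -/
theorem mk_canonicalRep {n : ℕ} (c : BraidGroup (2 * n) → ℕ) (C : PlatClass n) :
    DoubleCoset.mk (hilden n) (hilden n) (canonicalRep c C) = C :=
  (canonicalRep_mem_minimalBraids c C).1

theorem canonicalRep_injective {n : ℕ} (c : BraidGroup (2 * n) → ℕ) :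
    Function.Injective (canonicalRep c) :=
  Function.LeftInverse.injective (mk_canonicalRep c)

/-- For a proper complexity function, a set of plat presentation classes is finite if and only if
the complexity of the canonical representatives is bounded on it. -/
theorem finite_iff_exists_canonicalRep_le {n : ℕ} {c : BraidGroup (2 * n) → ℕ}
    (hc : IsProperComplexity c) (S : Set (PlatClass n)) :
    S.Finite ↔ ∃ N : ℕ, ∀ C ∈ S, c (canonicalRep c C) ≤ N := by
  constructor
  · intro hS
    obtain ⟨N, hN⟩ := (hS.image fun C => c (canonicalRep c C)).bddAbove
    exact ⟨N, fun C hC => hN ⟨C, hC, rfl⟩⟩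
  · rintro ⟨N, hN⟩
    -- By unfolding, `hN` says that `S` lies in the preimage of `{β | c β ≤ N}` under `canonicalRep
    -- c`; injectivity keeps this preimage finite.
    exact ((hc N).preimage (canonicalRep_injective c).injOn).subset hN

end Plat

/-- The link type only selects the set of classes to which the general criterion is applied. -/
theorem mainTheorem3 (n : ℕ) (hn : 1 ≤ n)
    (c : Plat.BraidGroup (2 * n) → ℕ) (hc : Plat.IsProperComplexity c)
    (L : Set (Set Plat.Sphere3)) (hL : Plat.IsLinkType L) :
    (Plat.platClasses n L).Finite ↔
      ∃ N : ℕ, ∀ C ∈ Plat.platClasses n L, c (Plat.canonicalRep c C) ≤ N :=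
  Plat.finite_iff_exists_canonicalRep_le hc _
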